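/- Let $t \ge s$, $k$ and $\omega$ be non-negative integers with $k \ge t/2$ and $\omega < (t+k)/2$. For a finite field $\mathbb F$ with $q$ elements and a feature set $A \subseteq \mathbb F$ put $\chi_A(X) = \prod_{x\in A}(X-x)$. A vault record of $A$ is a polynomial $V = f + \chi_A$ with $f \in \mathbb F[X]$, $\deg f < k$, where either $f$ is chosen uniformly at random among the polynomials of degree smaller than $k$ (probabilistic variant), or $-f$ is the sum of the terms of $\chi_A$ of degree smaller than $k$ (deterministic variant). There is a constant $K$, depending only on $t, s, k, \omega$, with the following property. Let $\mathbb F$ be a finite field with $q$ elements that has subsets $A, B$ with $|A| = t$, $|B| = s$, $|A\cap B| = \omega$; let $(A,B)$ be chosen uniformly at random among all such pairs, and let $V$ and $W$ be vault records of $A$ and $B$, each computed according to one of the two variants and with independent randomness. Then every (possibly randomized, computationally unbounded) algorithm that takes $V$ and $W$ as input outputs an element of $(A\cup B)\setminus(A\cap B)$ with probability at most $K/q$; that is, its success probability is in $\mathcal O(q^{-1})$. The probability is taken over the choice of $(A,B)$, the randomness of the records and the randomness of the algorithm. -/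

import Mathlib

namespace FuzzyVault

open Polynomial

/-- The characteristic polynomial `∏ x ∈ A, (X - x)` of a feature set `A`. -/
noncomputable def charPoly {F : Type*} [Field F] (A : Finset F) : F[X] :=
  ∏ x ∈ A, (X - C x)

/-- The polynomial of degree smaller than `k` with coefficients `c 0, …, c (k - 1)`. -/
noncomputable def polyOfCoeffs {F : Type*} [Field F] {k : ℕ} (c : Fin k → F) : F[X] :=
  ∑ i : Fin k, C (c i) * X ^ (i : ℕ)

/-- The two variants of the improved fuzzy vault scheme. -/
inductive Variant
  | probabilistic
  | deterministic

/-- The distribution of the vault record `f + charPoly A` of the feature set `A`, where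
`deg f < k`. In the probabilistic variant `f` is uniform among the polynomials of degree smaller
than `k`; in the deterministic variant `-f` consists of the `k` lowest terms of `charPoly A`. -/
noncomputable def vaultRecord {F : Type*} [Field F] [Fintype F] (k : ℕ) (A : Finset F) :
    Variant → PMF F[X]
  | .probabilistic =>
      (PMF.uniformOfFintype (Fin k → F)).map fun c => polyOfCoeffs c + charPoly A
  | .deterministic =>
      PMF.pure (-polyOfCoeffs (fun i : Fin k => (charPoly A).coeff i) + charPoly A)

/-- Pairs `(A, B)` of feature sets with `|A| = t`, `|B| = s` and `|A ∩ B| = ω`. -/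
def featurePairs (F : Type*) [Fintype F] [DecidableEq F] (t s ω : ℕ) :
    Finset (Finset F × Finset F) :=
  Finset.univ.filter fun P => P.1.card = t ∧ P.2.card = s ∧ (P.1 ∩ P.2).card = ω

/-- A randomized attack, without any restriction on its resources: it maps two vault records to
a random output, which is a field element or `none` (failure). -/
abbrev Attack (F : Type*) [Field F] := F[X] → F[X] → PMF (Option F)

/-- The joint distribution of the feature sets and the output of the attack: `(A, B)` is uniform
in `featurePairs F t s ω`, the two records are computed with independent randomness, and the
attack is run on them. -/
noncomputable def experiment {F : Type*} [Field F] [Fintype F] [DecidableEq F] {t s ω : ℕ}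
    (h : (featurePairs F t s ω).Nonempty) (k : ℕ) (v w : Variant) (𝒜 : Attack F) :
    PMF ((Finset F × Finset F) × Option F) :=
  (PMF.uniformOfFinset (featurePairs F t s ω) h).bind fun P =>
    (vaultRecord k P.1 v).bind fun V =>
      (vaultRecord k P.2 w).bind fun W =>
        (𝒜 V W).map fun out => (P, out)

/-- The probability that the attack outputs an element of `(A ∪ B) \ (A ∩ B)`. -/
noncomputable def successProb {F : Type*} [Field F] [Fintype F] [DecidableEq F] {t s ω : ℕ}
    (h : (featurePairs F t s ω).Nonempty) (k : ℕ) (v w : Variant) (𝒜 : Attack F) : ENNReal :=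
  (experiment h k v w 𝒜).toOuterMeasure
    {o | ∃ x ∈ (o.1.1 ∪ o.1.2) \ (o.1.1 ∩ o.1.2), o.2 = some x}

end FuzzyVault

/-! A record reveals only the part of `χ_A` of degree at least `k`: the low part is deleted or
masked uniformly (`vaultRecord_eq`). So an attack is a randomized guess from two high parts, of
which there are at most `q ^ ((t - k) + (s - k))` pairs (`card_highPart_image_le`), while the number
of `(A, B)` is at least a constant times `q ^ (t + s - ω)` (`pow_le_card_featurePairs`). It suffices
that fixing the high parts and one element `x` of the symmetric difference leaves at most `2 q ^ (t
+ s - ω - (t - k) - (s - k) - 1)` pairs (`card_consistent_mul_le`); `sum_guess_le` then sums over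
the fibres.

If `ω < k`, count `A ∩ B` first and then `A` and `B` over it; `x` costs one exponent. If `ω ≥ k`,
this is too weak. Instead compare `D = A \ B`, `E = B \ A` with a reference pair `D₀`, `E₀`: the
polynomial `χ_D χ_E₀ - χ_D₀ χ_E` determines `(D, E)`, has degree below `t + k - 2 ω` and vanishes at
`x`. The hypothesis on `ω` makes this bound positive, so the root really saves a factor `q`. -/

namespace FuzzyVault

open Polynomial

/-! ### Characteristic polynomials and their high parts -/

section Polynomials

variable {F : Type*} [Field F]

lemma monic_charPoly (A : Finset F) : (charPoly A).Monic :=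
  monic_prod_of_monic _ _ fun x _ => monic_X_sub_C x

lemma natDegree_charPoly (A : Finset F) : (charPoly A).natDegree = A.card := by
  simp [charPoly]

lemma degree_charPoly (A : Finset F) : (charPoly A).degree = A.card := by
  rw [degree_eq_natDegree (monic_charPoly A).ne_zero, natDegree_charPoly]

lemma eval_charPoly_eq_zero_iff (A : Finset F) (x : F) : (charPoly A).eval x = 0 ↔ x ∈ A := by
  simp [charPoly, eval_prod, Finset.prod_eq_zero_iff, sub_eq_zero]

lemma charPoly_injective : Function.Injective (charPoly : Finset F → F[X]) := by
  intro A B h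
  ext x
  rw [← eval_charPoly_eq_zero_iff, h, eval_charPoly_eq_zero_iff]

lemma charPoly_dvd_charPoly {A B : Finset F} (h : A ⊆ B) : charPoly A ∣ charPoly B :=
  Finset.prod_dvd_prod_of_subset _ _ _ h

lemma X_sub_C_dvd_charPoly {A : Finset F} {x : F} (h : x ∈ A) : X - C x ∣ charPoly A :=
  Finset.dvd_prod_of_mem _ h

lemma charPoly_inter_mul_sdiff [DecidableEq F] (A B : Finset F) :
    charPoly (A ∩ B) * charPoly (A \ B) = charPoly A := by
  rw [charPoly, charPoly, charPoly, ← Finset.prod_union (Finset.disjoint_sdiff_inter A B).symm,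
    Finset.union_comm, Finset.sdiff_union_inter]

lemma isCoprime_charPoly {A B : Finset F} (h : Disjoint A B) :
    IsCoprime (charPoly A) (charPoly B) := by
  refine IsCoprime.prod_left fun x hx => IsCoprime.prod_right fun y hy => ?_
  refine isCoprime_X_sub_C_of_isUnit_sub (sub_ne_zero.2 ?_).isUnit
  rintro rfl
  exact Finset.disjoint_left.1 h hx hy

lemma coeff_polyOfCoeffs {k : ℕ} (c : Fin k → F) (n : ℕ) :
    (polyOfCoeffs c).coeff n = if h : n < k then c ⟨n, h⟩ else 0 := by
  simp only [polyOfCoeffs, finsetSum_coeff, coeff_C_mul, coeff_X_pow]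
  split_ifs with h
  · rw [Finset.sum_eq_single ⟨n, h⟩]
    · simp
    · intro b _ hb
      rw [if_neg, mul_zero]
      rintro rfl
      exact hb rfl
    · simp
  · refine Finset.sum_eq_zero fun b _ => ?_
    rw [if_neg (by have := b.2; omega), mul_zero]

lemma polyOfCoeffs_add {k : ℕ} (c d : Fin k → F) :
    polyOfCoeffs (c + d) = polyOfCoeffs c + polyOfCoeffs d := by
  simp [polyOfCoeffs, add_mul, Finset.sum_add_distrib]

/-- The sum of the terms of `p` of degree at least `k`. -/
noncomputable def highPart (k : ℕ) (p : F[X]) : F[X] :=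
  -polyOfCoeffs (fun i : Fin k => p.coeff i) + p

lemma coeff_highPart (k : ℕ) (p : F[X]) (n : ℕ) :
    (highPart k p).coeff n = if n < k then 0 else p.coeff n := by
  rw [highPart, coeff_add, coeff_neg, coeff_polyOfCoeffs]
  split_ifs <;> simp

lemma degree_sub_lt_of_highPart_eq {k : ℕ} {p q : F[X]} (h : highPart k p = highPart k q) :
    (p - q).degree < k := by
  refine (degree_lt_iff_coeff_zero _ _).2 fun n hn => ?_
  have := congrArg (coeff · n) h
  simp only [coeff_highPart, hn.not_gt, if_false] at this
  rw [coeff_sub, this, sub_self]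

lemma degree_charPoly_sub_lt_card {t : ℕ} {A B : Finset F} (hA : A.card = t)
    (hB : B.card = t) : (charPoly A - charPoly B).degree < t := by
  rw [← hA, ← degree_charPoly A]
  refine degree_sub_lt_left ?_ (monic_charPoly A).ne_zero ?_
  · rw [degree_charPoly, degree_charPoly, hA, hB]
  · rw [(monic_charPoly A).leadingCoeff, (monic_charPoly B).leadingCoeff]

lemma degree_charPoly_sub_lt {k t : ℕ} {A B : Finset F} (hA : A.card = t) (hB : B.card = t)
    (h : highPart k (charPoly A) = highPart k (charPoly B)) :
    (charPoly A - charPoly B).degree < (min k t : ℕ) := by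
  rcases min_choice k t with e | e <;> rw [e]
  exacts [degree_sub_lt_of_highPart_eq h, degree_charPoly_sub_lt_card hA hB]

/-- A pair of disjoint sets `(D, E)` is determined by `D E₀ - D₀ E`. -/
lemma charPoly_cross_injective {D₀ E₀ D D' E E' : Finset F} (h₀ : Disjoint D₀ E₀)
    (hD : D.card = D₀.card) (hD' : D'.card = D₀.card)
    (h : charPoly D * charPoly E₀ - charPoly D₀ * charPoly E =
      charPoly D' * charPoly E₀ - charPoly D₀ * charPoly E') : D = D' ∧ E = E' := by
  have h1 : (charPoly D - charPoly D') * charPoly E₀ =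
      charPoly D₀ * (charPoly E - charPoly E') := by linear_combination h
  -- Both polynomials on the right are monic of degree `|D₀|`, so their difference has too small a
  -- degree to be a nonzero multiple of `χ_D₀`.
  have h2 : charPoly D₀ ∣ charPoly D - charPoly D' :=
    (isCoprime_charPoly h₀).dvd_of_dvd_mul_right ⟨_, h1⟩
  have h3 : charPoly D - charPoly D' = 0 := by
    refine eq_zero_of_dvd_of_degree_lt h2 ?_
    rw [degree_charPoly]
    exact degree_charPoly_sub_lt_card hD hD'
  rw [h3, zero_mul, eq_comm, mul_eq_zero, or_iff_right (monic_charPoly _).ne_zero] at h1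
  exact ⟨charPoly_injective (sub_eq_zero.1 h3), charPoly_injective (sub_eq_zero.1 h1)⟩

variable [Fintype F]

lemma card_le_pow_of_degree_lt {ι : Type*} (S : Finset ι) (φ : ι → F[X]) (d : ℕ)
    (hφ : Set.InjOn φ S) (hd : ∀ i ∈ S, (φ i).degree < d) :
    S.card ≤ Fintype.card F ^ d := by
  classical
  have : S.card ≤ (Finset.univ : Finset (Fin d → F)).card := by
    refine Finset.card_le_card_of_injOn (fun i j => (φ i).coeff j) (by simp) ?_
    intro i hi j hj hij
    refine hφ hi hj (Polynomial.ext fun n => ?_)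
    rcases lt_or_ge n d with hn | hn
    · exact congrFun hij ⟨n, hn⟩
    · rw [(degree_lt_iff_coeff_zero _ _).1 (hd i hi) n hn,
        (degree_lt_iff_coeff_zero _ _).1 (hd j hj) n hn]
  simpa using this

/-- Polynomials of degree smaller than `d` that are divisible by a fixed monic `g`. -/
lemma card_le_pow_of_dvd {ι : Type*} (S : Finset ι) (ψ : ι → F[X]) (d : ℕ) {g : F[X]}
    (hg : g.Monic) (hψ : Set.InjOn ψ S) (hd : ∀ i ∈ S, (ψ i).degree < d)
    (hdvd : ∀ i ∈ S, g ∣ ψ i) :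
    S.card ≤ Fintype.card F ^ (d - g.natDegree) := by
  have hmul : ∀ i ∈ S, ψ i = g * (ψ i /ₘ g) := fun i hi => by
    have := modByMonic_add_div (ψ i) g
    rwa [(modByMonic_eq_zero_iff_dvd hg).2 (hdvd i hi), zero_add, eq_comm] at this
  refine card_le_pow_of_degree_lt S (fun i => ψ i /ₘ g) _ ?_ ?_
  · intro i hi j hj hij
    refine hψ hi hj ?_
    rw [hmul i hi, hmul j hj]
    exact congrArg _ hij
  · intro i hi
    by_cases h0 : ψ i /ₘ g = 0
    · simp only [h0, degree_zero]
      exact WithBot.bot_lt_coe _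
    have h1 := hd i hi
    rw [hmul i hi, degree_mul, degree_eq_natDegree hg.ne_zero, degree_eq_natDegree h0] at h1
    rw [degree_eq_natDegree h0]
    norm_cast at h1 ⊢
    omega

/-- Relative to one fixed member `A₀`, each difference `χ_A - χ_A₀` is a multiple of `χ_G` of degree
below `min k t`. -/
lemma card_supersets_le (k t : ℕ) (G : Finset F) (V : F[X]) (S : Finset (Finset F))
    (hS : ∀ A ∈ S, A.card = t ∧ G ⊆ A ∧ highPart k (charPoly A) = V) :
    S.card ≤ Fintype.card F ^ (min k t - G.card) := by
  rcases S.eq_empty_or_nonempty with rfl | ⟨A₀, h₀⟩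
  · simp
  obtain ⟨hc₀, hG₀, hV₀⟩ := hS A₀ h₀
  rw [← natDegree_charPoly G]
  refine card_le_pow_of_dvd S (fun A => charPoly A - charPoly A₀) _ (monic_charPoly G) ?_ ?_ ?_
  · intro A _ B _ h
    exact charPoly_injective (sub_left_injective h)
  · intro A hA
    obtain ⟨hc, hG, hV⟩ := hS A hA
    exact degree_charPoly_sub_lt hc hc₀ (hV.trans hV₀.symm)
  · intro A hA
    exact dvd_sub (charPoly_dvd_charPoly (hS A hA).2.1) (charPoly_dvd_charPoly hG₀)

lemma card_highPart_image_le (k t : ℕ) (S : Finset F[X])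
    (hS : ∀ V ∈ S, ∃ A : Finset F, A.card = t ∧ highPart k (charPoly A) = V) :
    S.card ≤ Fintype.card F ^ (t - k) := by
  have : S.card ≤ (Finset.univ : Finset (Fin (t - k) → F)).card := by
    refine Finset.card_le_card_of_injOn (fun V j => V.coeff (k + j)) (by simp) ?_
    intro V hV W hW h
    obtain ⟨A, hA, rfl⟩ := hS V hV
    obtain ⟨B, hB, rfl⟩ := hS W hW
    ext n
    rw [coeff_highPart, coeff_highPart]
    split_ifs with hn
    · rfl
    rcases lt_trichotomy n t with h1 | rfl | h1
    · have := congrFun h ⟨n - k, by omega⟩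
      simpa [coeff_highPart, show k + (n - k) = n by omega, hn] using this
    -- The coefficient at `t` is always 1, so `t - k` coordinates suffice.
    · have e1 := (monic_charPoly A).coeff_natDegree
      have e2 := (monic_charPoly B).coeff_natDegree
      rw [natDegree_charPoly] at e1 e2
      rw [hA] at e1
      rw [hB] at e2
      rw [e1, e2]
    · rw [coeff_eq_zero_of_natDegree_lt, coeff_eq_zero_of_natDegree_lt] <;>
        rw [natDegree_charPoly] <;> omega
  simpa using this

end Polynomials

/-! ### Counting feature pairs with prescribed high parts -/

section Counting

variable {F : Type*} [Field F] [Fintype F] [DecidableEq F]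

/-- `(A, B)` has the prescribed cardinalities, and `χ_A` and `χ_B` have the prescribed high
parts. -/
def IsConsistent (t s ω k : ℕ) (V W : F[X]) (P : Finset F × Finset F) : Prop :=
  P.1.card = t ∧ P.2.card = s ∧ (P.1 ∩ P.2).card = ω ∧
    highPart k (charPoly P.1) = V ∧ highPart k (charPoly P.2) = W

variable {t s ω k : ℕ} {V W : F[X]}

/-- The last factor counts the intersections `C`; for given `C`, the sets `A ⊇ C ∪ X` and `B ⊇ C ∪
Y` are counted separately. -/
lemma card_consistent_le_of_subsets (X Y : Finset F) (S : Finset (Finset F × Finset F))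
    (hS : ∀ P ∈ S, IsConsistent t s ω k V W P ∧ X ⊆ P.1 \ P.2 ∧ Y ⊆ P.2 \ P.1) :
    S.card ≤ Fintype.card F ^ (min k t - (ω + X.card)) *
      Fintype.card F ^ (min k s - (ω + Y.card)) * Fintype.card F ^ ω := by
  have himg : (S.image fun P => P.1 ∩ P.2).card ≤ Fintype.card F ^ ω := by
    refine le_trans (Finset.card_le_card (t := Finset.powersetCard ω Finset.univ) ?_) ?_
    · intro C hC
      obtain ⟨P, hP, rfl⟩ := Finset.mem_image.1 hC
      exact Finset.mem_powersetCard_univ.2 (hS P hP).1.2.2.1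
    · rw [Finset.card_powersetCard, Finset.card_univ]
      exact Nat.choose_le_pow _ _
  refine (Finset.card_le_mul_card_image S _ fun C hC => ?_).trans (Nat.mul_le_mul_left _ himg)
  obtain ⟨P₀, hP₀, rfl⟩ := Finset.mem_image.1 hC
  obtain ⟨⟨-, -, hω, -, -⟩, hX, hY⟩ := hS P₀ hP₀
  have hcX : (P₀.1 ∩ P₀.2 ∪ X).card = ω + X.card := by
    rw [Finset.card_union_of_disjoint, hω]
    exact (Finset.disjoint_sdiff_inter _ _).symm.mono_right hX
  have hcY : (P₀.1 ∩ P₀.2 ∪ Y).card = ω + Y.card := by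
    rw [Finset.card_union_of_disjoint, hω]
    rw [Finset.inter_comm]
    exact (Finset.disjoint_sdiff_inter _ _).symm.mono_right hY
  set T := S.filter fun P => P.1 ∩ P.2 = P₀.1 ∩ P₀.2 with hT
  have h1 := card_supersets_le k t (P₀.1 ∩ P₀.2 ∪ X) V (T.image Prod.fst) (by
    intro A hA
    obtain ⟨P, hP, rfl⟩ := Finset.mem_image.1 hA
    obtain ⟨hPS, hPC⟩ := Finset.mem_filter.1 hP
    obtain ⟨⟨hA, -, -, hV, -⟩, hX, -⟩ := hS P hPS
    refine ⟨hA, ?_, hV⟩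
    rw [← hPC]
    exact Finset.union_subset Finset.inter_subset_left (hX.trans Finset.sdiff_subset))
  have h2 := card_supersets_le k s (P₀.1 ∩ P₀.2 ∪ Y) W (T.image Prod.snd) (by
    intro A hA
    obtain ⟨P, hP, rfl⟩ := Finset.mem_image.1 hA
    obtain ⟨hPS, hPC⟩ := Finset.mem_filter.1 hP
    obtain ⟨⟨-, hB, -, -, hW⟩, -, hY⟩ := hS P hPS
    refine ⟨hB, ?_, hW⟩
    rw [← hPC]
    exact Finset.union_subset Finset.inter_subset_right (hY.trans Finset.sdiff_subset))
  rw [hcX] at h1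
  rw [hcY] at h2
  calc T.card ≤ (T.image Prod.fst ×ˢ T.image Prod.snd).card :=
        Finset.card_le_card Finset.subset_product
    _ ≤ _ := by
        rw [Finset.card_product]
        exact Nat.mul_le_mul h1 h2

omit [Fintype F] in
/-- For consistent `(A, B)` and `(A₀, B₀)` the products `χ_(A \ B) χ_(B₀ \ A₀)` and
`χ_(A₀ \ B₀) χ_(B \ A)` agree in all but their `t + k - 2 ω` lowest terms. -/
lemma degree_charPoly_cross_lt (hst : s ≤ t) (hω : 2 * ω < t + k)
    {P Q : Finset F × Finset F} (hP : IsConsistent t s ω k V W P)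
    (hQ : IsConsistent t s ω k V W Q) :
    (charPoly (P.1 \ P.2) * charPoly (Q.2 \ Q.1) -
      charPoly (Q.1 \ Q.2) * charPoly (P.2 \ P.1)).degree < (t + k - 2 * ω : ℕ) := by
  obtain ⟨A, B⟩ := P
  obtain ⟨A₀, B₀⟩ := Q
  obtain ⟨hA, hB, hAB, hV, hW⟩ := hP
  obtain ⟨hA₀, hB₀, hAB₀, hV₀, hW₀⟩ := hQ
  dsimp only at *
  have e1 := charPoly_inter_mul_sdiff A B
  have e2 := charPoly_inter_mul_sdiff B A
  have e3 := charPoly_inter_mul_sdiff A₀ B₀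
  have e4 := charPoly_inter_mul_sdiff B₀ A₀
  rw [Finset.inter_comm] at e2 e4
  set R := charPoly (A \ B) * charPoly (B₀ \ A₀) - charPoly (A₀ \ B₀) * charPoly (B \ A)
  -- Multiplying by both intersections turns `R` into `χ_A χ_B₀ - χ_A₀ χ_B`, which is rewritten
  -- through differences of degree below `k`; the cofactors have degrees `s ≤ t` and `t`.
  have key : charPoly (A ∩ B) * charPoly (A₀ ∩ B₀) * R =
      (charPoly A - charPoly A₀) * charPoly B₀ - charPoly A₀ * (charPoly B - charPoly B₀) := by
    rw [← e1, ← e2, ← e3, ← e4]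
    ring
  have hdA := degree_sub_lt_of_highPart_eq (hV.trans hV₀.symm)
  have hdB := degree_sub_lt_of_highPart_eq (hW.trans hW₀.symm)
  have hR : (charPoly (A ∩ B) * charPoly (A₀ ∩ B₀) * R).degree < (t + k : ℕ) := by
    rw [key]
    refine (degree_sub_le _ _).trans_lt (max_lt ?_ ?_)
    · by_cases h0 : charPoly A - charPoly A₀ = 0
      · rw [h0, zero_mul, degree_zero]
        exact WithBot.bot_lt_coe _
      rw [degree_eq_natDegree h0] at hdA
      rw [degree_mul, degree_charPoly, degree_eq_natDegree h0]
      norm_cast at hdA ⊢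
      omega
    · by_cases h0 : charPoly B - charPoly B₀ = 0
      · rw [h0, mul_zero, degree_zero]
        exact WithBot.bot_lt_coe _
      rw [degree_eq_natDegree h0] at hdB
      rw [degree_mul, degree_charPoly, degree_eq_natDegree h0]
      norm_cast at hdB ⊢
      omega
  by_cases h0 : R = 0
  · rw [h0, degree_zero]
    exact WithBot.bot_lt_coe _
  rw [degree_mul, degree_mul, degree_charPoly, degree_charPoly, degree_eq_natDegree h0,
    hAB, hAB₀] at hR
  rw [degree_eq_natDegree h0]
  norm_cast at hR ⊢
  omega

/-- The second factor counts the pairs `(A \ B, B \ A)` through their cross polynomials, all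
divisible by `X - x`; the first counts the `A` containing a given `A \ B`. -/
lemma card_consistent_le_of_cross (hst : s ≤ t) (hω : 2 * ω < t + k) (x : F)
    (S : Finset (Finset F × Finset F)) (hS : ∀ P ∈ S, IsConsistent t s ω k V W P)
    (hx : (∀ P ∈ S, x ∈ P.1 \ P.2) ∨ ∀ P ∈ S, x ∈ P.2 \ P.1) :
    S.card ≤ Fintype.card F ^ (min k t - (t - ω)) * Fintype.card F ^ (t + k - 2 * ω - 1) := by
  rcases S.eq_empty_or_nonempty with rfl | ⟨Q, hQ⟩
  · simp
  have hcard : ∀ P ∈ S, (P.1 \ P.2).card = t - ω := fun P hP => by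
    rw [Finset.card_sdiff, Finset.inter_comm, (hS P hP).1, (hS P hP).2.2.1]
  have himg : (S.image fun P => (P.1 \ P.2, P.2 \ P.1)).card ≤
      Fintype.card F ^ (t + k - 2 * ω - 1) := by
    have := card_le_pow_of_dvd (S.image fun P => (P.1 \ P.2, P.2 \ P.1))
      (fun P => charPoly P.1 * charPoly (Q.2 \ Q.1) - charPoly (Q.1 \ Q.2) * charPoly P.2)
      (t + k - 2 * ω) (monic_X_sub_C x) ?_ ?_ ?_
    · rwa [natDegree_X_sub_C] at this
    · intro P hP P' hP' h
      obtain ⟨R, hR, rfl⟩ := Finset.mem_image.1 hP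
      obtain ⟨R', hR', rfl⟩ := Finset.mem_image.1 hP'
      have := charPoly_cross_injective (disjoint_sdiff_sdiff (x := Q.1) (y := Q.2))
        ((hcard R hR).trans (hcard Q hQ).symm) ((hcard R' hR').trans (hcard Q hQ).symm) h
      exact Prod.ext this.1 this.2
    · intro P hP
      obtain ⟨R, hR, rfl⟩ := Finset.mem_image.1 hP
      exact degree_charPoly_cross_lt hst hω (hS R hR) (hS Q hQ)
    · intro P hP
      obtain ⟨R, hR, rfl⟩ := Finset.mem_image.1 hP
      rcases hx with hx | hx
      · exact dvd_sub (dvd_mul_of_dvd_left (X_sub_C_dvd_charPoly (hx R hR)) _)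
          (dvd_mul_of_dvd_left (X_sub_C_dvd_charPoly (hx Q hQ)) _)
      · exact dvd_sub (dvd_mul_of_dvd_right (X_sub_C_dvd_charPoly (hx Q hQ)) _)
          (dvd_mul_of_dvd_right (X_sub_C_dvd_charPoly (hx R hR)) _)
  refine (Finset.card_le_mul_card_image S _ fun DE hDE => ?_).trans (Nat.mul_le_mul_left _ himg)
  obtain ⟨R, hR, rfl⟩ := Finset.mem_image.1 hDE
  set T := S.filter fun P => (P.1 \ P.2, P.2 \ P.1) = (R.1 \ R.2, R.2 \ R.1) with hT
  have hTS : ∀ P ∈ T, P ∈ S ∧ P.1 \ P.2 = R.1 \ R.2 ∧ P.2 \ P.1 = R.2 \ R.1 := fun P hP => by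
    simpa [hT] using hP
  -- Once both differences are fixed, `A` determines `B`.
  have hinj : Set.InjOn Prod.fst (T : Set (Finset F × Finset F)) := by
    have hsnd : ∀ P : Finset F × Finset F, P.2 = P.1 \ (P.1 \ P.2) ∪ P.2 \ P.1 := fun P => by
      ext y
      simp only [Finset.mem_union, Finset.mem_sdiff]
      tauto
    intro P hP P' hP' h
    refine Prod.ext h ?_
    rw [hsnd P, hsnd P', (hTS P hP).2.1, (hTS P hP).2.2, (hTS P' hP').2.1, (hTS P' hP').2.2, h]
  rw [← Finset.card_image_of_injOn hinj, ← hcard R hR]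
  refine card_supersets_le k t _ V _ fun A hA => ?_
  obtain ⟨P, hP, rfl⟩ := Finset.mem_image.1 hA
  obtain ⟨hPS, h1, -⟩ := hTS P hP
  refine ⟨(hS P hPS).1, ?_, (hS P hPS).2.2.2.1⟩
  rw [← h1]
  exact Finset.sdiff_subset

/-- If `x` lies in all sets of the first, or all sets of the second kind, then the number of
consistent pairs is smaller by a factor `q` than on average. -/
lemma card_consistent_mul_le_of_mem (hst : s ≤ t) (hk : t ≤ 2 * k) (hω : 2 * ω < t + k) (x : F)
    (S : Finset (Finset F × Finset F)) (hS : ∀ P ∈ S, IsConsistent t s ω k V W P)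
    (hx : (∀ P ∈ S, x ∈ P.1 \ P.2) ∨ ∀ P ∈ S, x ∈ P.2 \ P.1) :
    S.card * Fintype.card F ^ ((t - k) + (s - k) + 1) ≤ Fintype.card F ^ (t + s - ω) := by
  rcases S.eq_empty_or_nonempty with rfl | ⟨Q, hQ⟩
  · simp
  have hq : 0 < Fintype.card F := Fintype.card_pos
  obtain ⟨hA, hB, hAB, -, -⟩ := hS Q hQ
  have hωt : ω ≤ t := by rw [← hA, ← hAB]; exact Finset.card_le_card Finset.inter_subset_left
  have hωs : ω ≤ s := by rw [← hB, ← hAB]; exact Finset.card_le_card Finset.inter_subset_right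
  have hlt : ω < t := by
    rcases hx with hx | hx
    · have := Finset.card_pos.2 ⟨x, hx Q hQ⟩
      rw [Finset.card_sdiff, Finset.inter_comm, hA, hAB] at this
      omega
    · have := Finset.card_pos.2 ⟨x, hx Q hQ⟩
      rw [Finset.card_sdiff, hB, hAB] at this
      omega
  -- For `ω < k` no exponent in the subset count is truncated. For `k ≤ ω`, `t ≤ 2 * k` gives `t - ω
  -- ≤ k`, so the cross count is not truncated either.
  rcases lt_or_ge ω k with hωk | hωk
  · rcases hx with hx | hx
    · have := card_consistent_le_of_subsets {x} ∅ S fun P hP =>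
        ⟨hS P hP, Finset.singleton_subset_iff.2 (hx P hP), Finset.empty_subset _⟩
      refine (Nat.mul_le_mul_right _ this).trans ?_
      rw [← pow_add, ← pow_add, ← pow_add, Finset.card_singleton, Finset.card_empty]
      exact Nat.pow_le_pow_right hq (by omega)
    · have := card_consistent_le_of_subsets ∅ {x} S fun P hP =>
        ⟨hS P hP, Finset.empty_subset _, Finset.singleton_subset_iff.2 (hx P hP)⟩
      have hlts := Finset.card_pos.2 ⟨x, hx Q hQ⟩
      rw [Finset.card_sdiff, hB, hAB] at hlts
      refine (Nat.mul_le_mul_right _ this).trans ?_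
      rw [← pow_add, ← pow_add, ← pow_add, Finset.card_singleton, Finset.card_empty]
      exact Nat.pow_le_pow_right hq (by omega)
  · refine (Nat.mul_le_mul_right _ (card_consistent_le_of_cross hst hω x S hS hx)).trans ?_
    rw [← pow_add, ← pow_add]
    exact Nat.pow_le_pow_right hq (by omega)

lemma card_consistent_mul_le (hst : s ≤ t) (hk : t ≤ 2 * k) (hω : 2 * ω < t + k) (x : F)
    (S : Finset (Finset F × Finset F))
    (hS : ∀ P ∈ S, IsConsistent t s ω k V W P ∧ x ∈ (P.1 ∪ P.2) \ (P.1 ∩ P.2)) :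
    S.card * Fintype.card F ^ ((t - k) + (s - k) + 1) ≤ 2 * Fintype.card F ^ (t + s - ω) := by
  rw [← Finset.card_filter_add_card_filter_not (s := S) (fun P => x ∈ P.1), add_mul, two_mul]
  refine Nat.add_le_add ?_ ?_
  · refine card_consistent_mul_le_of_mem (V := V) (W := W) hst hk hω x _
      (fun P hP => (hS P (Finset.mem_filter.1 hP).1).1) (Or.inl fun P hP => ?_)
    obtain ⟨hP, hx⟩ := Finset.mem_filter.1 hP
    have := (hS P hP).2
    simp only [Finset.mem_sdiff, Finset.mem_inter, not_and] at this ⊢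
    exact ⟨hx, this.2 hx⟩
  · refine card_consistent_mul_le_of_mem (V := V) (W := W) hst hk hω x _
      (fun P hP => (hS P (Finset.mem_filter.1 hP).1).1) (Or.inr fun P hP => ?_)
    obtain ⟨hP, hx⟩ := Finset.mem_filter.1 hP
    have := (hS P hP).2
    simp only [Finset.mem_sdiff, Finset.mem_union] at this ⊢
    exact ⟨this.1.resolve_left hx, hx⟩

omit [Field F] in
-- Every set of size `t + s - ω` is a union `A ∪ B`, so a binomial coefficient bounds the count from
-- below. Nonemptiness makes the field large enough for it to be comparable with the power of `q`.
lemma pow_le_card_featurePairs (h : (featurePairs F t s ω).Nonempty) :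
    Fintype.card F ^ (t + s - ω) ≤
      ((t + s - ω) ^ (t + s - ω) * (t + s - ω).factorial) * (featurePairs F t s ω).card := by
  obtain ⟨Q, hQ⟩ := h
  obtain ⟨-, hQ1, hQ2, hQ3⟩ := Finset.mem_filter.1 hQ
  have hωt : ω ≤ t := by rw [← hQ1, ← hQ3]; exact Finset.card_le_card Finset.inter_subset_left
  have hωs : ω ≤ s := by rw [← hQ2, ← hQ3]; exact Finset.card_le_card Finset.inter_subset_right
  have hm : t + s - ω ≤ Fintype.card F := by
    rw [← hQ1, ← hQ2, ← hQ3, ← Finset.card_union]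
    exact Finset.card_le_univ _
  have hch : (Fintype.card F).choose (t + s - ω) ≤ (featurePairs F t s ω).card := by
    rw [← Finset.card_univ, ← Finset.card_powersetCard]
    refine Finset.card_le_card_of_surjOn (fun P => P.1 ∪ P.2) fun U hU => ?_
    have hU : U.card = t + s - ω := Finset.mem_powersetCard_univ.1 hU
    obtain ⟨A, hAU, hA⟩ := Finset.exists_subset_card_eq (s := U) (n := t) (by omega)
    obtain ⟨C, hCA, hC⟩ := Finset.exists_subset_card_eq (s := A) (n := ω) (by omega)
    have hdisj : Disjoint C (U \ A) := Finset.disjoint_sdiff.mono_left hCA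
    refine ⟨(A, C ∪ U \ A),
      Finset.mem_coe.2 (Finset.mem_filter.2 ⟨Finset.mem_univ _, hA, ?_, ?_⟩), ?_⟩
    · rw [Finset.card_union_of_disjoint hdisj, Finset.card_sdiff_of_subset hAU]
      omega
    · have : A ∩ (C ∪ U \ A) = C := by
        rw [Finset.inter_union_distrib_left, Finset.inter_sdiff_self, Finset.union_empty,
          Finset.inter_eq_right.2 hCA]
      exact (congrArg _ this).trans hC
    · change A ∪ (C ∪ U \ A) = U
      rw [← Finset.union_assoc, Finset.union_eq_left.2 hCA, Finset.union_sdiff_of_subset hAU]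
  generalize t + s - ω = m at *
  generalize Fintype.card F = q at *
  have h1 : (q + 1 - m) ^ m ≤ m.factorial * q.choose m := by
    rw [← Nat.descFactorial_eq_factorial_mul_choose]
    exact Nat.pow_sub_le_descFactorial q m
  have h2 : q ^ m ≤ (m * (q + 1 - m)) ^ m := by
    rcases m.eq_zero_or_pos with rfl | hpos
    · simp
    refine Nat.pow_le_pow_left ?_ _
    obtain ⟨d, rfl⟩ := Nat.exists_eq_add_of_le hm
    rw [show m + d + 1 - m = d + 1 by omega]
    nlinarith
  calc q ^ m ≤ m ^ m * (q + 1 - m) ^ m := by rwa [← mul_pow]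
    _ ≤ m ^ m * (m.factorial * q.choose m) := Nat.mul_le_mul_left _ h1
    _ ≤ m ^ m * (m.factorial * (featurePairs F t s ω).card) := by gcongr
    _ = _ := by ring

end Counting

/-! ### Reduction of attacks to guesses from high parts -/

section Probability

variable {F : Type*} [Field F] [Fintype F]

/-- The vault record that belongs to the high part `V` of a characteristic polynomial. -/
noncomputable def recordOfHighPart (k : ℕ) : Variant → F[X] → PMF F[X]
  | .probabilistic, V => (PMF.uniformOfFintype (Fin k → F)).map fun c => polyOfCoeffs c + V
  | .deterministic, V => PMF.pure V

lemma map_uniformOfFintype_equiv {α : Type*} [Fintype α] [Nonempty α] (e : α ≃ α) :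
    (PMF.uniformOfFintype α).map e = PMF.uniformOfFintype α := by
  ext a
  rw [PMF.map_apply, tsum_eq_single (e.symm a)]
  · simp
  · intro b hb
    rw [if_neg]
    rintro rfl
    simp at hb

/-- In the probabilistic variant, translating the uniform mask by the low coefficients of `χ_A`
leaves it uniform. -/
lemma vaultRecord_eq (k : ℕ) (A : Finset F) (v : Variant) :
    vaultRecord k A v = recordOfHighPart k v (highPart k (charPoly A)) := by
  cases v with
  | deterministic => rfl
  | probabilistic =>
    rw [vaultRecord, recordOfHighPart]
    conv_rhs =>
      rw [← map_uniformOfFintype_equiv (Equiv.addRight fun i : Fin k => (charPoly A).coeff i),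
        PMF.map_comp]
    congr 1
    funext c
    simp only [Function.comp_apply, Equiv.coe_addRight, polyOfCoeffs_add, highPart]
    ring

variable [DecidableEq F]

/-- The attack on two high parts that completes them to records and runs `𝒜`. -/
noncomputable def attackOnHighParts (k : ℕ) (v w : Variant) (𝒜 : Attack F) : Attack F :=
  fun V W =>
    (recordOfHighPart k v V).bind fun V' => (recordOfHighPart k w W).bind fun W' => 𝒜 V' W'

variable {t s ω : ℕ}

lemma experiment_eq (h : (featurePairs F t s ω).Nonempty) (k : ℕ) (v w : Variant)
    (𝒜 : Attack F) :
    experiment h k v w 𝒜 = (PMF.uniformOfFinset (featurePairs F t s ω) h).bind fun P =>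
      (attackOnHighParts k v w 𝒜 (highPart k (charPoly P.1)) (highPart k (charPoly P.2))).map
        fun out => (P, out) := by
  simp only [experiment, attackOnHighParts, vaultRecord_eq, PMF.map_bind]

lemma successProb_eq (h : (featurePairs F t s ω).Nonempty) (k : ℕ) (v w : Variant)
    (𝒜 : Attack F) :
    successProb h k v w 𝒜 = ((featurePairs F t s ω).card : ENNReal)⁻¹ *
      ∑ P ∈ featurePairs F t s ω, ∑ o : Option F,
        if ∃ x ∈ (P.1 ∪ P.2) \ (P.1 ∩ P.2), o = some x then
          attackOnHighParts k v w 𝒜 (highPart k (charPoly P.1)) (highPart k (charPoly P.2)) o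
        else 0 := by
  rw [successProb, experiment_eq, PMF.toOuterMeasure_bind_apply,
    tsum_eq_sum (s := featurePairs F t s ω), Finset.mul_sum]
  · refine Finset.sum_congr rfl fun P hP => ?_
    rw [PMF.uniformOfFinset_apply_of_mem _ hP, PMF.toOuterMeasure_map_apply,
      PMF.toOuterMeasure_apply_fintype]
    congr 1
    refine Finset.sum_congr rfl fun o _ => ?_
    split_ifs with ho
    · exact Set.indicator_of_mem (by simpa using ho) _
    · exact Set.indicator_of_notMem (by simpa using ho) _
  · intro P hP
    rw [PMF.uniformOfFinset_apply_of_notMem _ hP, zero_mul]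

/-- If every output is correct for at most `M` of the pairs of each fibre of `f`, then a
randomized guess from the value of `f` is correct with total weight at most `M` per fibre. -/
lemma sum_guess_le {ι κ β : Type*} [DecidableEq κ] [Fintype β] (S : Finset ι) (f : ι → κ)
    (a : κ → PMF β) (r : ι → β → Prop) [∀ i o, Decidable (r i o)] (M : ℕ)
    (hM : ∀ z o, (S.filter fun i => f i = z ∧ r i o).card ≤ M) :
    ∑ i ∈ S, ∑ o, (if r i o then a (f i) o else 0) ≤ ((S.image f).card * M : ℕ) := by
  rw [← Finset.sum_fiberwise_of_maps_to (g := f) (t := S.image f)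
    (fun i hi => Finset.mem_image_of_mem f hi), Nat.cast_mul, ← nsmul_eq_mul]
  refine Finset.sum_le_card_nsmul _ _ _ fun z _ => ?_
  rw [Finset.sum_comm]
  calc ∑ o, ∑ i ∈ S.filter (fun i => f i = z), (if r i o then a (f i) o else 0)
      ≤ ∑ o, a z o * M := by
        refine Finset.sum_le_sum fun o _ => ?_
        rw [← Finset.sum_filter, Finset.filter_filter]
        calc ∑ i ∈ S.filter (fun i => f i = z ∧ r i o), a (f i) o
            = ∑ i ∈ S.filter (fun i => f i = z ∧ r i o), a z o :=
              Finset.sum_congr rfl fun i hi => by rw [(Finset.mem_filter.1 hi).2.1]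
          _ = (S.filter fun i => f i = z ∧ r i o).card * a z o := by
              rw [Finset.sum_const, nsmul_eq_mul]
          _ ≤ a z o * M := by
              rw [mul_comm]
              gcongr
              exact hM z o
    _ = M := by
        rw [← Finset.sum_mul, ← tsum_fintype (L := .unconditional _), PMF.tsum_coe, one_mul]

end Probability

/-! ### The explicit bound -/

theorem successProb_le {F : Type*} [Field F] [Fintype F] [DecidableEq F] {t s k ω : ℕ}
    (hst : s ≤ t) (hk : t ≤ 2 * k) (hω : 2 * ω < t + k)
    (h : (featurePairs F t s ω).Nonempty) (v w : Variant) (𝒜 : Attack F) :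
    successProb h k v w 𝒜 ≤
      ((2 * ((t + s - ω) ^ (t + s - ω) * (t + s - ω).factorial) : ℕ) : ENNReal) /
        (Fintype.card F : ENNReal) := by
  classical
  set N := (featurePairs F t s ω).card with hN
  set q := Fintype.card F with hq
  have hq0 : 0 < q := Fintype.card_pos
  have hN0 : 0 < N := Finset.card_pos.2 h
  set f : Finset F × Finset F → F[X] × F[X] :=
    fun P => (highPart k (charPoly P.1), highPart k (charPoly P.2)) with hf
  set r : Finset F × Finset F → Option F → Prop :=
    fun P o => ∃ x ∈ (P.1 ∪ P.2) \ (P.1 ∩ P.2), o = some x with hr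
  set c := (t + s - ω) ^ (t + s - ω) * (t + s - ω).factorial with hc
  have hM : ∀ z o, ((featurePairs F t s ω).filter fun P => f P = z ∧ r P o).card ≤
      2 * q ^ (t + s - ω) / q ^ ((t - k) + (s - k) + 1) := by
    rintro ⟨V, W⟩ o
    rw [Nat.le_div_iff_mul_le (pow_pos hq0 _)]
    cases o with
    | none => simp [hr]
    | some x =>
      refine card_consistent_mul_le (V := V) (W := W) hst hk hω x _ fun P hP => ?_
      obtain ⟨hP, hfP, y, hy, hxy⟩ := Finset.mem_filter.1 hP
      obtain ⟨-, h1, h2, h3⟩ := Finset.mem_filter.1 hP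
      obtain rfl : x = y := by simpa using hxy
      exact ⟨⟨h1, h2, h3, congrArg Prod.fst hfP, congrArg Prod.snd hfP⟩, hy⟩
  have himg : ((featurePairs F t s ω).image f).card ≤ q ^ ((t - k) + (s - k)) := by
    rw [pow_add]
    refine (Finset.card_le_card Finset.subset_product).trans ?_
    rw [Finset.card_product, Finset.image_image, Finset.image_image]
    refine Nat.mul_le_mul (card_highPart_image_le k t _ fun V hV => ?_)
      (card_highPart_image_le k s _ fun V hV => ?_)
    all_goals
      obtain ⟨P, hP, rfl⟩ := Finset.mem_image.1 hV
      obtain ⟨-, h1, h2, -⟩ := Finset.mem_filter.1 hP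
    exacts [⟨P.1, h1, rfl⟩, ⟨P.2, h2, rfl⟩]
  have hsum := sum_guess_le (featurePairs F t s ω) f
    (fun z => attackOnHighParts k v w 𝒜 z.1 z.2) r _ hM
  -- The number of fibres times `q` is exactly the divisor in the fibre bound, so rounding down in
  -- the quotient does no harm.
  have hnat : ((featurePairs F t s ω).image f).card *
      (2 * q ^ (t + s - ω) / q ^ ((t - k) + (s - k) + 1)) * q ≤ 2 * c * N := by
    calc _ ≤ q ^ ((t - k) + (s - k)) *
          (2 * q ^ (t + s - ω) / q ^ ((t - k) + (s - k) + 1)) * q := by gcongr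
      _ = 2 * q ^ (t + s - ω) / q ^ ((t - k) + (s - k) + 1) * q ^ ((t - k) + (s - k) + 1) := by
          ring
      _ ≤ 2 * q ^ (t + s - ω) := Nat.div_mul_le_self _ _
      _ ≤ 2 * (c * N) := Nat.mul_le_mul_left _ (pow_le_card_featurePairs h)
      _ = _ := by ring
  rw [successProb_eq, ENNReal.le_div_iff_mul_le (by simp [hq0.ne']) (by simp), mul_assoc,
    mul_comm, ← div_eq_mul_inv]
  refine ENNReal.div_le_of_le_mul ?_
  refine (mul_le_mul_left (le_trans (le_of_eq ?_) hsum) (q : ENNReal)).trans ?_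
  · refine Finset.sum_congr rfl fun P _ => Finset.sum_congr rfl fun o _ => ?_
    congr
  · exact_mod_cast hnat

end FuzzyVault

theorem mainTheorem9 (t s k ω : ℕ) (hst : s ≤ t) (hk : (t : ℝ) / 2 ≤ k)
    (hω : (ω : ℝ) < ((t : ℝ) + k) / 2) :
    ∃ K : NNReal, ∀ (F : Type*) [Field F] [Fintype F] [DecidableEq F]
      (h : (FuzzyVault.featurePairs F t s ω).Nonempty)
      (v w : FuzzyVault.Variant) (𝒜 : FuzzyVault.Attack F),
      FuzzyVault.successProb h k v w 𝒜 ≤ (K : ENNReal) / (Fintype.card F : ENNReal) := by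
  have hk' : t ≤ 2 * k := by
    have : (t : ℝ) ≤ 2 * k := by linarith
    exact_mod_cast this
  have hω' : 2 * ω < t + k := by
    have : (2 : ℝ) * ω < t + k := by linarith
    exact_mod_cast this
  refine ⟨((2 * ((t + s - ω) ^ (t + s - ω) * (t + s - ω).factorial) : ℕ) : NNReal),
    fun F _ _ _ h v w 𝒜 => ?_⟩
  rw [ENNReal.coe_natCast]
  exact FuzzyVault.successProb_le hst hk' hω' h v w 𝒜
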